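/- **Proposition 5.1.** Let $G$ be a group, written additively but not assumed abelian, let $ZG$ be its centre and $\mu_c(a)=c+a-c$. Let $\mathbf{Aut}_G$ be the strict Gr-category (strict monoidal category in which all morphisms are invertible and all objects are $\otimes$-invertible) whose objects are the automorphisms of $G$, with $\mathrm{Hom}(\alpha,\beta)=\{c\in G\mid \alpha=\mu_c\circ\beta\}$, composition $d\circ c=c+d$, and $\alpha\otimes\beta=\alpha\circ\beta$, $(\alpha\xrightarrow{c}\alpha')\otimes(\beta\xrightarrow{d}\beta')=c+\alpha'(d)$. For a Gr-category $\mathbb G$ with unit object $I$, let $\pi_0\mathbb G$ be the group of isomorphism classes of objects and $\pi_1\mathbb G=\mathrm{Aut}(I)$, a $\pi_0\mathbb G$-module by $[X]u=\gamma_X^{-1}\delta_X(u)$, where $\gamma_X(u),\delta_X(u)\in\mathrm{Aut}(X)$ correspond under the unit constraints $I\otimes X\cong X\cong X\otimes I$ to $u\otimes \mathrm{id}_X$ and $\mathrm{id}_X\otimes u$. A stick of $\mathbb G$ is a choice of an object $X_s$ in each class $s\in\pi_0\mathbb G$, with $X_1=I$, and of isomorphisms $i_Y:X_s\to Y$ for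 all $Y\in s$, such that $i_{X_s}=\mathrm{id}$ and $i_{I\otimes X_s}$, $i_{X_s\otimes I}$ are given by the unit constraints. The corresponding reduced Gr-category $S_{\mathbb G}$ has the elements of $\pi_0\mathbb G$ as objects, the pairs $(s,u):s\to s$ with $u\in\pi_1\mathbb G$ as morphisms, composition $(s,u)(s,v)=(s,u+v)$, tensor product $(s,u)\otimes(t,v)=(st,u+sv)$, strict unit constraints, and the associativity constraint transported from $\mathbb G$ along the equivalence $H:S_{\mathbb G}\to\mathbb G$, $H(s)=X_s$, $H(s,u)=\gamma_{X_s}(u)$, $\widetilde H_{s,t}=i_{X_s\otimes X_t}^{-1}:X_s\otimes X_t\to X_{st}$. Write this constraint as $(rst,h(r,s,t)):r\otimes(s\otimes t)\to(r\otimes s)\otimes t$. i) There are isomorphisms of groups $\pi_0(\mathbf{Aut}_G)\cong\mathrm{Aut}\,G/\mathrm{In}\,G$, $[\alpha]\mapsto\alpha\,\mathrm{In}\,G$, and $\pi_1(\mathbf{Aut}_G)\cong ZG$, $c\mapsto c$, compatible with the actions, where $\mathrm{Aut}\,G/\mathrm{In}\,G$ acts on $ZG$ by evaluation of automorphisms.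 Identify along them. For every stick of $\mathbf{Aut}_G$, the associativity constraint $h$ of the reduced Gr-category is a normalized 3-cocycle of $\mathrm{Aut}\,G/\mathrm{In}\,G$ with values in $ZG$. ii) Let $(\Pi,G,\psi)$ be an abstract kernel, i.e. $\psi:\Pi\to\mathrm{Aut}\,G/\mathrm{In}\,G$ is a homomorphism of groups, and regard $ZG$ as a $\Pi$-module through $\psi$. For all $\varphi(x)\in\psi(x)$ with $\varphi(1)=\mathrm{id}_G$ and all $f:\Pi^2\to G$ with $\varphi(x)\varphi(y)=\mu_{f(x,y)}\varphi(xy)$, the function $k:\Pi^3\to ZG$ determined by $$\varphi(x)[f(y,z)]+f(x,yz)=k(x,y,z)+f(x,y)+f(xy,z)$$ is a 3-cocycle (its class is the obstruction of the kernel), and for every stick of $\mathbf{Aut}_G$, with $(\psi^*h)(x,y,z)=h(\psi x,\psi y,\psi z)$, $$[\psi^*h]=-[k]\quad\text{in }H^3(\Pi,ZG).$$ Equivalently, if $h^-=-h$ denotes the function describing the inverse constraint $(r\otimes s)\otimes t\to r\otimes(s\otimes t)$, then $[\psi^*h^-]=[k]$. -/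

import Mathlib

open CategoryTheory MonoidalCategory

universe v u w

noncomputable section

namespace GrCat

/-! ### Gr-categories and their invariants -/

section IsoClasses

variable (C : Type u) [Category.{v} C]

/-- `π₀`: the isomorphism classes of objects. -/
def Pi0 : Type u := Quotient (isIsomorphicSetoid C)

variable {C} in
/-- The class of an object. -/
def Pi0.mk (X : C) : Pi0 C := Quotient.mk (isIsomorphicSetoid C) X

variable {C}

theorem Pi0.mk_eq_iff {X Y : C} : Pi0.mk X = Pi0.mk Y ↔ Nonempty (X ≅ Y) :=
  ⟨fun h => Quotient.exact h, fun h => Quotient.sound h⟩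

theorem Pi0.sound {X Y : C} (e : X ≅ Y) : Pi0.mk X = Pi0.mk Y := Pi0.mk_eq_iff.2 ⟨e⟩

theorem Pi0.ind {p : Pi0 C → Prop} (h : ∀ X : C, p (Pi0.mk X)) (s : Pi0 C) : p s :=
  Quotient.ind h s

end IsoClasses

section Invariants

variable (C : Type u) [Category.{v} C] [MonoidalCategory C]

/-- A Gr-category (categorical group): a monoidal category in which every morphism is an
isomorphism and every object is invertible for the tensor product. -/
class IsGrCategory : Prop where
  isIso {X Y : C} (f : X ⟶ Y) : IsIso f
  exists_inv (X : C) : ∃ Y : C, Nonempty (X ⊗ Y ≅ 𝟙_ C) ∧ Nonempty (Y ⊗ X ≅ 𝟙_ C)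

/-- A monoidal category is strict if its constraints are identities: the tensor product is
strictly associative and unital on objects, and the constraint isomorphisms are the
canonical morphisms attached to these equalities of objects. -/
class IsStrict : Prop where
  assoc_obj (X Y Z : C) : (X ⊗ Y) ⊗ Z = X ⊗ (Y ⊗ Z)
  unit_tensor (X : C) : 𝟙_ C ⊗ X = X
  tensor_unit (X : C) : X ⊗ 𝟙_ C = X
  associator_eq (X Y Z : C) : α_ X Y Z = eqToIso (assoc_obj X Y Z)
  leftUnitor_eq (X : C) : λ_ X = eqToIso (unit_tensor X)
  rightUnitor_eq (X : C) : ρ_ X = eqToIso (tensor_unit X)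

variable {C}

/-- The product on `π₀` induced by the tensor product. -/
instance : Mul (Pi0 C) where
  mul := Quotient.map₂ (fun X Y : C => X ⊗ Y) fun _ _ ⟨e⟩ _ _ ⟨e'⟩ => ⟨e ⊗ᵢ e'⟩

instance : One (Pi0 C) := ⟨Pi0.mk (𝟙_ C)⟩

theorem Pi0.mk_tensor (X Y : C) : Pi0.mk (X ⊗ Y) = Pi0.mk X * Pi0.mk Y := rfl

theorem Pi0.mk_unit : Pi0.mk (𝟙_ C) = 1 := rfl

/-- The inverse class in `π₀` of a Gr-category. -/
instance [IsGrCategory C] : Inv (Pi0 C) where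
  inv := Quotient.lift
    (fun X : C => Pi0.mk (Classical.choose (IsGrCategory.exists_inv X)))
    (by
      rintro X X' ⟨e⟩
      obtain ⟨⟨_⟩, ⟨e₂⟩⟩ := Classical.choose_spec (IsGrCategory.exists_inv X)
      obtain ⟨⟨e₃⟩, ⟨_⟩⟩ := Classical.choose_spec (IsGrCategory.exists_inv X')
      set Y := Classical.choose (IsGrCategory.exists_inv X)
      set Y' := Classical.choose (IsGrCategory.exists_inv X')
      exact Pi0.sound ((ρ_ Y).symm ≪≫ whiskerLeftIso Y e₃.symm ≪≫
        whiskerLeftIso Y (whiskerRightIso e.symm Y') ≪≫ (α_ Y X Y').symm ≪≫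
        whiskerRightIso e₂ Y' ≪≫ λ_ Y'))

/-- `π₀` of a Gr-category is a group under the tensor product. -/
instance [IsGrCategory C] : Group (Pi0 C) :=
  Group.ofLeftAxioms
    (by
      refine Pi0.ind fun X => Pi0.ind fun Y => Pi0.ind fun Z => ?_
      exact Pi0.sound (α_ X Y Z))
    (Pi0.ind fun X => Pi0.sound (λ_ X))
    (Pi0.ind fun X => by
      obtain ⟨⟨_⟩, ⟨e⟩⟩ := Classical.choose_spec (IsGrCategory.exists_inv X)
      exact Pi0.sound e)

/-- Automorphisms of the unit object commute. -/
instance : CommGroup (Aut (𝟙_ C)) where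
  mul_comm f g := by
    have hf : f.hom = (ρ_ (𝟙_ C)).inv ≫ f.hom ▷ 𝟙_ C ≫ (ρ_ (𝟙_ C)).hom := by simp
    have hg : g.hom = (ρ_ (𝟙_ C)).inv ≫ 𝟙_ C ◁ g.hom ≫ (ρ_ (𝟙_ C)).hom := by
      rw [← unitors_equal, ← unitors_inv_equal]; simp
    ext
    change g.hom ≫ f.hom = f.hom ≫ g.hom
    rw [hf, hg]
    simp only [Category.assoc, Iso.hom_inv_id_assoc]
    rw [whisker_exchange_assoc]

variable (C) in
/-- `π₁`: the automorphisms of the unit object under composition, written additively. -/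
abbrev Pi1 : Type v := Additive (Aut (𝟙_ C))

/-- `γ_X(u) = l_X ∘ (u ⊗ id) ∘ l_X⁻¹`. -/
def gamma (X : C) : Aut (𝟙_ C) →* Aut X where
  toFun u := (λ_ X).symm ≪≫ whiskerRightIso u X ≪≫ λ_ X
  map_one' := by
    ext
    change (λ_ X).inv ≫ 𝟙 (𝟙_ C) ▷ X ≫ (λ_ X).hom = 𝟙 X
    simp
  map_mul' u w := by
    ext
    change (λ_ X).inv ≫ (w.hom ≫ u.hom) ▷ X ≫ (λ_ X).hom =
      ((λ_ X).inv ≫ w.hom ▷ X ≫ (λ_ X).hom) ≫ ((λ_ X).inv ≫ u.hom ▷ X ≫ (λ_ X).hom)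
    simp

/-- `δ_X(u) = r_X ∘ (id ⊗ u) ∘ r_X⁻¹`. -/
def delta (X : C) : Aut (𝟙_ C) →* Aut X where
  toFun u := (ρ_ X).symm ≪≫ whiskerLeftIso X u ≪≫ ρ_ X
  map_one' := by
    ext
    change (ρ_ X).inv ≫ X ◁ 𝟙 (𝟙_ C) ≫ (ρ_ X).hom = 𝟙 X
    simp
  map_mul' u w := by
    ext
    change (ρ_ X).inv ≫ X ◁ (w.hom ≫ u.hom) ≫ (ρ_ X).hom =
      ((ρ_ X).inv ≫ X ◁ w.hom ≫ (ρ_ X).hom) ≫ ((ρ_ X).inv ≫ X ◁ u.hom ≫ (ρ_ X).hom)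
    simp

theorem gamma_hom (X : C) (u : Aut (𝟙_ C)) :
    (gamma X u).hom = (λ_ X).inv ≫ u.hom ▷ X ≫ (λ_ X).hom := rfl

theorem delta_hom (X : C) (u : Aut (𝟙_ C)) :
    (delta X u).hom = (ρ_ X).inv ≫ X ◁ u.hom ≫ (ρ_ X).hom := rfl

theorem gamma_natural {X Y : C} (f : X ⟶ Y) (u : Aut (𝟙_ C)) :
    (gamma X u).hom ≫ f = f ≫ (gamma Y u).hom := by
  rw [gamma_hom, gamma_hom]
  generalize (Iso.hom u : 𝟙_ C ⟶ 𝟙_ C) = a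
  simp only [Category.assoc]
  rw [← leftUnitor_naturality, ← whisker_exchange_assoc, leftUnitor_inv_naturality_assoc]

theorem delta_natural {X Y : C} (f : X ⟶ Y) (u : Aut (𝟙_ C)) :
    (delta X u).hom ≫ f = f ≫ (delta Y u).hom := by
  rw [delta_hom, delta_hom]
  generalize (Iso.hom u : 𝟙_ C ⟶ 𝟙_ C) = a
  simp only [Category.assoc]
  rw [← rightUnitor_naturality, whisker_exchange_assoc, rightUnitor_inv_naturality_assoc]

theorem gamma_tensor (X Y : C) (u : Aut (𝟙_ C)) :
    (gamma (X ⊗ Y) u).hom = (gamma X u).hom ▷ Y := by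
  simp only [gamma_hom, comp_whiskerRight]
  simp

theorem delta_tensor (X Y : C) (u : Aut (𝟙_ C)) :
    (delta (X ⊗ Y) u).hom = X ◁ (delta Y u).hom := by
  simp only [delta_hom, MonoidalCategory.whiskerLeft_comp]
  simp

theorem whiskerLeft_gamma (X Y : C) (u : Aut (𝟙_ C)) :
    X ◁ (gamma Y u).hom = (delta X u).hom ▷ Y := by
  simp only [gamma_hom, delta_hom, comp_whiskerRight, MonoidalCategory.whiskerLeft_comp]
  simp

theorem isEquivalence_tensorRight [IsGrCategory C] (X : C) :
    (tensorRight X).IsEquivalence := by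
  obtain ⟨Y, ⟨e₁⟩, ⟨e₂⟩⟩ := IsGrCategory.exists_inv X
  exact Functor.IsEquivalence.mk' (tensorRight Y)
    ((rightUnitorNatIso C).symm ≪≫ (tensoringRight C).mapIso e₁.symm ≪≫ tensorRightTensor X Y)
    ((tensorRightTensor Y X).symm ≪≫ (tensoringRight C).mapIso e₂ ≪≫ rightUnitorNatIso C)

theorem gamma_bijective [IsGrCategory C] (X : C) : Function.Bijective (gamma X) := by
  have := isEquivalence_tensorRight X
  constructor
  · intro u w h
    have h' := congrArg Iso.hom h
    simp only [gamma_hom, Iso.cancel_iso_inv_left, Iso.cancel_iso_hom_right] at h'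
    ext
    exact (tensorRight X).map_injective h'
  · intro f
    refine ⟨(tensorRight X).preimageIso ((λ_ X) ≪≫ f ≪≫ (λ_ X).symm), ?_⟩
    ext
    have : ((tensorRight X).preimageIso ((λ_ X) ≪≫ f ≪≫ (λ_ X).symm)).hom ▷ X =
        (λ_ X).hom ≫ f.hom ≫ (λ_ X).inv :=
      (tensorRight X).map_preimage _
    change (λ_ X).inv ≫ ((tensorRight X).preimageIso ((λ_ X) ≪≫ f ≪≫ (λ_ X).symm)).hom ▷ X ≫
      (λ_ X).hom = Iso.hom f
    rw [this]
    simp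

/-- In a Gr-category `γ_X` is an isomorphism of groups. -/
def gammaEquiv [IsGrCategory C] (X : C) : Aut (𝟙_ C) ≃* Aut X :=
  MulEquiv.ofBijective (gamma X) (gamma_bijective X)

theorem gamma_gammaEquiv_symm [IsGrCategory C] (X : C) (f : Aut X) :
    gamma X ((gammaEquiv X).symm f) = f := (gammaEquiv X).apply_symm_apply f

/-- The action `[X] u = γ_X⁻¹ (δ_X u)` of `π₀` on `π₁`. -/
instance [IsGrCategory C] : SMul (Pi0 C) (Pi1 C) where
  smul s u := Quotient.lift
    (fun X : C => Additive.ofMul ((gammaEquiv X).symm (delta X u.toMul)))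
    (by
      rintro X Y ⟨e⟩
      refine congrArg Additive.ofMul ((gammaEquiv Y).injective ?_)
      rw [MulEquiv.apply_symm_apply]
      ext
      change (gamma Y _).hom = _
      rw [← cancel_epi e.hom, ← gamma_natural, gamma_gammaEquiv_symm, delta_natural]) s

theorem gamma_smul [IsGrCategory C] (X : C) (u : Pi1 C) :
    gamma X (Pi0.mk X • u).toMul = delta X u.toMul := gamma_gammaEquiv_symm X _

theorem gamma_smul_of_eq [IsGrCategory C] {X : C} {s : Pi0 C} (h : Pi0.mk X = s) (u : Pi1 C) :
    gamma X (s • u).toMul = delta X u.toMul := by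
  subst h
  exact gamma_smul X u

/-- `π₁` is a `π₀`-module. -/
instance [IsGrCategory C] : DistribMulAction (Pi0 C) (Pi1 C) where
  one_smul u := by
    refine Additive.toMul.injective ((gamma_bijective (𝟙_ C)).1 ?_)
    rw [← Pi0.mk_unit, gamma_smul]
    ext
    rw [gamma_hom, delta_hom, unitors_equal, unitors_inv_equal]
    rw [whiskerRight_id, id_whiskerLeft, unitors_equal, unitors_inv_equal]
  mul_smul s t u := by
    revert s t
    refine Pi0.ind fun X => Pi0.ind fun Y => ?_
    refine Additive.toMul.injective ((gamma_bijective (X ⊗ Y)).1 ?_)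
    ext
    rw [← Pi0.mk_tensor, gamma_smul, gamma_tensor, gamma_smul, delta_tensor,
      ← whiskerLeft_gamma, gamma_smul]
  smul_zero s := by
    revert s
    refine Pi0.ind fun X => ?_
    refine Additive.toMul.injective ((gamma_bijective X).1 ?_)
    rw [gamma_smul, toMul_zero, map_one, map_one]
  smul_add s u w := by
    revert s
    refine Pi0.ind fun X => ?_
    refine Additive.toMul.injective ((gamma_bijective X).1 ?_)
    rw [gamma_smul, toMul_add, toMul_add, map_mul, map_mul, gamma_smul, gamma_smul]

end Invariants

/-! ### The reduced Gr-category -/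

section Auxiliary

variable {C : Type u} [Category.{v} C]

theorem assoc_aux {X₀ X₁ X₂ X₃ X₄ X₅ X₆ : C} (a : X₀ ⟶ X₁) (b : X₁ ⟶ X₂) (c : X₂ ⟶ X₃)
    (d : X₃ ⟶ X₄) (e : X₄ ⟶ X₅) (f : X₅ ⟶ X₆) :
    (a ≫ b ≫ c ≫ d ≫ e) ≫ f = a ≫ b ≫ c ≫ d ≫ e ≫ f := by simp

variable [MonoidalCategory C]

theorem inv_aux {R S T A D RS ST : C} (a : A ≅ R ⊗ ST) (b : ST ≅ S ⊗ T) (c : RS ≅ R ⊗ S)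
    (d : D ≅ RS ⊗ T) :
    (((d.symm.symm ≪≫ (c.symm.symm ⊗ᵢ Iso.refl T)) ≪≫ α_ R S T ≪≫
      ((Iso.refl R ⊗ᵢ b.symm) ≪≫ a.symm))).inv =
      a.hom ≫ R ◁ b.hom ≫ (α_ R S T).inv ≫ c.inv ▷ T ≫ d.inv := by
  simp

theorem left_aux {A I X : C} (a : A ≅ I ⊗ X) (a' : X ≅ I ⊗ X) (e : I ≅ 𝟙_ C) (p : A ⟶ X)
    (h : p ≫ a'.hom = a.hom ≫ (𝟙 I ⊗ₘ 𝟙 X)) (h' : a'.hom ≫ e.hom ▷ X ≫ (λ_ X).hom = 𝟙 X) :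
    𝟙 A ≫ p = ((a.symm.symm ≪≫ (e.symm.symm ⊗ᵢ Iso.refl X)) ≪≫ λ_ X).hom := by
  rw [id_tensorHom_id, Category.comp_id] at h
  simp [← h, h']

theorem right_aux {A I X : C} (a : A ≅ X ⊗ I) (a' : X ≅ X ⊗ I) (e : I ≅ 𝟙_ C) (p : A ⟶ X)
    (h : p ≫ a'.hom = a.hom ≫ (𝟙 X ⊗ₘ 𝟙 I)) (h' : a'.hom ≫ X ◁ e.hom ≫ (ρ_ X).hom = 𝟙 X) :
    𝟙 A ≫ p = ((a.symm.symm ≪≫ (Iso.refl X ⊗ᵢ e.symm.symm)) ≪≫ ρ_ X).hom := by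
  rw [id_tensorHom_id, Category.comp_id] at h
  simp [← h, h']

end Auxiliary

section Reduced

/-- A stick of a Gr-category: a representative `X_s` of each class `s ∈ π₀`, with `X_1 = I`, and
for each object `Y` of the class `s` an isomorphism `i_Y : X_s ⟶ Y`, such that `i_{X_s} = id`
and such that `i_{I ⊗ X_s}` and `i_{X_s ⊗ I}` are given by the unit constraints. -/
structure Stick (C : Type u) [Category.{v} C] [MonoidalCategory C] [IsGrCategory C] where
  X : Pi0 C → C
  mk_X : ∀ s, Pi0.mk (X s) = s
  i : ∀ {s : Pi0 C} (Y : C), Pi0.mk Y = s → (X s ≅ Y)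
  X_one : X 1 = 𝟙_ C
  i_self : ∀ s (h : Pi0.mk (X s) = s), i (X s) h = Iso.refl (X s)
  i_unit_tensor : ∀ s (h : Pi0.mk (𝟙_ C ⊗ X s) = s), i (𝟙_ C ⊗ X s) h = (λ_ (X s)).symm
  i_tensor_unit : ∀ s (h : Pi0.mk (X s ⊗ 𝟙_ C) = s), i (X s ⊗ 𝟙_ C) h = (ρ_ (X s)).symm

variable {C : Type u} [Category.{v} C] [MonoidalCategory C] [IsGrCategory C]

/-- The isomorphism `i_{X_s ⊗ X_t}` with source `X_r`, where `r = st`. -/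
def Stick.iTensor (σ : Stick C) {r : Pi0 C} (s t : Pi0 C) (h : r = s * t) :
    σ.X r ≅ σ.X s ⊗ σ.X t :=
  σ.i (σ.X s ⊗ σ.X t) (by rw [Pi0.mk_tensor, σ.mk_X, σ.mk_X, h])

/-- The automorphism
`X_{r(st)} → X_r ⊗ X_{st} → X_r ⊗ (X_s ⊗ X_t) → (X_r ⊗ X_s) ⊗ X_t → X_{rs} ⊗ X_t → X_{r(st)}`
(where `X_{r(st)} = X_{(rs)t}`): the associativity constraint `X ⊗ (Y ⊗ Z) → (X ⊗ Y) ⊗ Z`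
transported along the isomorphisms of the stick. -/
def Stick.assocAut (σ : Stick C) (r s t : Pi0 C) : Aut (σ.X (r * (s * t))) :=
  σ.iTensor r (s * t) rfl ≪≫ whiskerLeftIso (σ.X r) (σ.iTensor s t rfl) ≪≫
    (α_ (σ.X r) (σ.X s) (σ.X t)).symm ≪≫ whiskerRightIso (σ.iTensor r s rfl).symm (σ.X t) ≪≫
    (σ.iTensor (r * s) t (mul_assoc r s t).symm).symm

/-- The underlying type of the reduced Gr-category of `C` with respect to a stick:
its objects are the elements of `π₀`. -/
@[ext]
structure Reduced (σ : Stick C) : Type u where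
  cls : Pi0 C

/-- A morphism of the reduced category exists only from `s` to `s`, and is then an
element of `π₁`. -/
@[ext]
structure Reduced.Hom {σ : Stick C} (s t : Reduced σ) : Type v where
  eq : s.cls = t.cls
  val : Pi1 C

variable {σ : Stick C}

/-- Composition in the reduced category is the addition of `π₁`. -/
instance : Category (Reduced σ) where
  Hom s t := Reduced.Hom s t
  id _ := ⟨rfl, 0⟩
  comp f g := ⟨f.eq.trans g.eq, g.val + f.val⟩
  id_comp f := Reduced.Hom.ext (add_zero f.val)
  comp_id f := Reduced.Hom.ext (zero_add f.val)
  assoc f g h := Reduced.Hom.ext (add_assoc h.val g.val f.val).symm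

theorem Reduced.hom_ext {s t : Reduced σ} {f g : s ⟶ t} (h : f.val = g.val) : f = g :=
  Reduced.Hom.ext h

/-- The isomorphism of the reduced category given by an element of `π₁`. -/
def Reduced.mkIso {s t : Reduced σ} (h : s.cls = t.cls) (u : Pi1 C) : s ≅ t where
  hom := ⟨h, u⟩
  inv := ⟨h.symm, -u⟩
  hom_inv_id := Reduced.hom_ext (neg_add_cancel u)
  inv_hom_id := Reduced.hom_ext (add_neg_cancel u)

/-- The tensor product `(s,u) ⊗ (t,w) = (st, u + sw)`, the strict unit constraints, and the
associativity constraint `r(st) → (rs)t` transported from `C`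
(Mathlib's associator is the inverse morphism `(rs)t → r(st)`). -/
instance : MonoidalCategoryStruct (Reduced σ) where
  tensorObj s t := ⟨s.cls * t.cls⟩
  tensorUnit := ⟨1⟩
  tensorHom {s _ _ _} f g :=
    ⟨congrArg₂ (· * ·) f.eq g.eq, f.val + s.cls • g.val⟩
  whiskerLeft s {_ _} g := ⟨congrArg (s.cls * ·) g.eq, s.cls • g.val⟩
  whiskerRight {_ _} f t := ⟨congrArg (· * t.cls) f.eq, f.val⟩
  associator r s t := (Reduced.mkIso (mul_assoc r.cls s.cls t.cls).symm
    (Additive.ofMul ((gammaEquiv _).symm (σ.assocAut r.cls s.cls t.cls)))).symm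
  leftUnitor s := Reduced.mkIso (one_mul s.cls) 0
  rightUnitor s := Reduced.mkIso (mul_one s.cls) 0

variable (σ) in
/-- The canonical equivalence `H` from the reduced category to `C`:
`H(s) = X_s` and `H(s,u) = γ_{X_s}(u)`. -/
def Reduced.H : Reduced σ ⥤ C where
  obj s := σ.X s.cls
  map {s t} f := (gamma (σ.X s.cls) f.val.toMul).hom ≫ eqToHom (congrArg σ.X f.eq)
  map_id s := by
    change (gamma (σ.X s.cls) 1).hom ≫ eqToHom rfl = 𝟙 _
    rw [map_one, eqToHom_refl, Category.comp_id]
    rfl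
  map_comp {r s t} f g := by
    obtain ⟨r⟩ := r
    obtain ⟨s⟩ := s
    obtain ⟨t⟩ := t
    obtain ⟨hf, u⟩ := f
    obtain ⟨hg, w⟩ := g
    dsimp only at hf hg
    subst hf hg
    change (gamma (σ.X r) (w.toMul * u.toMul)).hom ≫ eqToHom rfl =
      ((gamma (σ.X r) u.toMul).hom ≫ eqToHom rfl) ≫ ((gamma (σ.X r) w.toMul).hom ≫ eqToHom rfl)
    simp only [eqToHom_refl, Category.comp_id, map_mul]
    rfl

theorem Reduced.H_map {s t : Reduced σ} (h : s.cls = t.cls) (u : Pi1 C) :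
    (Reduced.H σ).map (⟨h, u⟩ : Reduced.Hom s t) =
      (gamma (σ.X s.cls) u.toMul).hom ≫ eqToHom (congrArg σ.X h) := rfl

instance : (Reduced.H σ).Faithful where
  map_injective {s t} f g h := by
    have h' : (gamma (σ.X s.cls) f.val.toMul).hom = (gamma (σ.X s.cls) g.val.toMul).hom :=
      (cancel_mono _).1 h
    exact Reduced.hom_ext (Additive.toMul.injective
      ((gamma_bijective (σ.X s.cls)).1 (Iso.ext h')))

theorem Stick.iTensor_hom (σ : Stick C) {r r' s s' t t' : Pi0 C} (h : r = s * t)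
    (hr : r = r') (hs : s = s') (ht : t = t') (h' : r' = s' * t') :
    eqToHom (congrArg σ.X hr) ≫ (σ.iTensor s' t' h').hom =
      (σ.iTensor s t h).hom ≫ (eqToHom (congrArg σ.X hs) ⊗ₘ eqToHom (congrArg σ.X ht)) := by
  subst hr hs ht
  simp

theorem Reduced.H_tensorHom {s s' t t' : Reduced σ} (f : s ⟶ s') (g : t ⟶ t') :
    (Reduced.H σ).map (f ⊗ₘ g) ≫ (σ.iTensor s'.cls t'.cls rfl).hom =
      (σ.iTensor s.cls t.cls rfl).hom ≫ ((Reduced.H σ).map f ⊗ₘ (Reduced.H σ).map g) := by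
  obtain ⟨s⟩ := s
  obtain ⟨s'⟩ := s'
  obtain ⟨t⟩ := t
  obtain ⟨t'⟩ := t'
  obtain ⟨hf, u⟩ := f
  obtain ⟨hg, w⟩ := g
  dsimp only at hf hg
  subst hf hg
  change ((gamma (σ.X (s * t)) (u.toMul * (s • w).toMul)).hom ≫ eqToHom rfl) ≫ _ =
    _ ≫ (((gamma (σ.X s) u.toMul).hom ≫ eqToHom rfl) ⊗ₘ
      ((gamma (σ.X t) w.toMul).hom ≫ eqToHom rfl))
  simp only [eqToHom_refl, Category.comp_id]
  rw [gamma_natural, map_mul]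
  congr 1
  change (gamma _ (s • w).toMul).hom ≫ (gamma _ u.toMul).hom = _
  have hs : gamma (σ.X s) (s • w).toMul = delta (σ.X s) w.toMul := gamma_smul_of_eq (σ.mk_X s) w
  rw [gamma_tensor, gamma_tensor, hs, ← whiskerLeft_gamma, tensorHom_def']

theorem Reduced.H_assoc_inv (r s t : Reduced σ) :
    (Reduced.H σ).map (α_ r s t).inv =
      (σ.iTensor r.cls (s.cls * t.cls) rfl).hom ≫ σ.X r.cls ◁ (σ.iTensor s.cls t.cls rfl).hom ≫
        (α_ (σ.X r.cls) (σ.X s.cls) (σ.X t.cls)).inv ≫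
        (σ.iTensor r.cls s.cls rfl).inv ▷ σ.X t.cls ≫
        (σ.iTensor (r.cls * s.cls) t.cls rfl).inv := by
  have h1 : (Reduced.H σ).map (α_ r s t).inv = (gamma (σ.X (r.cls * (s.cls * t.cls)))
      ((gammaEquiv _).symm (σ.assocAut r.cls s.cls t.cls))).hom ≫
        eqToHom (congrArg σ.X (mul_assoc r.cls s.cls t.cls).symm) := rfl
  rw [h1, gamma_gammaEquiv_symm]
  have h2 : (σ.assocAut r.cls s.cls t.cls).hom =
      (σ.iTensor r.cls (s.cls * t.cls) rfl).hom ≫ σ.X r.cls ◁ (σ.iTensor s.cls t.cls rfl).hom ≫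
        (α_ (σ.X r.cls) (σ.X s.cls) (σ.X t.cls)).inv ≫
        (σ.iTensor r.cls s.cls rfl).inv ▷ σ.X t.cls ≫
        (σ.iTensor (r.cls * s.cls) t.cls (mul_assoc r.cls s.cls t.cls).symm).inv := rfl
  have h3 := σ.iTensor_hom (mul_assoc r.cls s.cls t.cls).symm
    (mul_assoc r.cls s.cls t.cls).symm rfl rfl rfl
  simp only [eqToHom_refl, id_tensorHom_id, Category.comp_id] at h3
  rw [h2]
  exact (assoc_aux _ _ _ _ _ _).trans (congrArg (fun m => _ ≫ _ ≫ _ ≫ _ ≫ m)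
    (((Iso.eq_comp_inv _).2 ((Category.assoc _ _ _).trans
      ((Iso.inv_comp_eq _).2 (h3.trans (Category.comp_id _).symm)))).trans (Category.id_comp _)))

theorem Reduced.H_whiskerLeft (s : Reduced σ) {t t' : Reduced σ} (g : t ⟶ t') :
    (Reduced.H σ).map (s ◁ g) ≫ (σ.iTensor s.cls t'.cls rfl).hom =
      (σ.iTensor s.cls t.cls rfl).hom ≫ ((Reduced.H σ).obj s ◁ (Reduced.H σ).map g) := by
  have h : s ◁ g = 𝟙 s ⊗ₘ g := Reduced.hom_ext (zero_add _).symm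
  rw [h]
  refine (Reduced.H_tensorHom (𝟙 s) g).trans (congrArg (fun m => _ ≫ m) ?_)
  exact (congrArg (fun m => m ⊗ₘ (Reduced.H σ).map g) ((Reduced.H σ).map_id s)).trans
    (MonoidalCategory.id_tensorHom _ _)

theorem Reduced.H_whiskerRight {s s' : Reduced σ} (f : s ⟶ s') (t : Reduced σ) :
    (Reduced.H σ).map (f ▷ t) ≫ (σ.iTensor s'.cls t.cls rfl).hom =
      (σ.iTensor s.cls t.cls rfl).hom ≫ ((Reduced.H σ).map f ▷ (Reduced.H σ).obj t) := by
  have h : f ▷ t = f ⊗ₘ 𝟙 t := Reduced.hom_ext (by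
    change f.val = f.val + s.cls • (0 : Pi1 C)
    rw [smul_zero, add_zero])
  rw [h]
  refine (Reduced.H_tensorHom f (𝟙 t)).trans (congrArg (fun m => _ ≫ m) ?_)
  exact (congrArg (fun m => (Reduced.H σ).map f ⊗ₘ m) ((Reduced.H σ).map_id t)).trans
    (MonoidalCategory.tensorHom_id _ _)

theorem Stick.unit_tensor (σ : Stick C) (s : Pi0 C) :
    (σ.iTensor 1 s (one_mul s).symm).hom ≫ (σ.i (s := 1) (𝟙_ C) rfl).hom ▷ σ.X s ≫
      (λ_ (σ.X s)).hom = 𝟙 (σ.X s) := by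
  obtain ⟨X, mk_X, i, X_one, i_self, i_unit_tensor, i_tensor_unit⟩ := σ
  have key : ∀ (I : C) (hI : I = 𝟙_ C) (h1 : Pi0.mk (I ⊗ X s) = s) (e : I ≅ 𝟙_ C)
      (_ : e = eqToIso hI),
      (i (I ⊗ X s) h1).hom ≫ e.hom ▷ X s ≫ (λ_ (X s)).hom = 𝟙 (X s) := by
    rintro I rfl h1 e rfl
    rw [i_unit_tensor]
    simp
  refine key (X 1) X_one _ _ ?_
  have key2 : ∀ (I : C) (hI : X 1 = I) (h : Pi0.mk I = 1), i I h = eqToIso hI := by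
    rintro I rfl h
    exact i_self 1 h
  exact key2 _ X_one _

theorem Stick.tensor_unit (σ : Stick C) (s : Pi0 C) :
    (σ.iTensor s 1 (mul_one s).symm).hom ≫ σ.X s ◁ (σ.i (s := 1) (𝟙_ C) rfl).hom ≫
      (ρ_ (σ.X s)).hom = 𝟙 (σ.X s) := by
  obtain ⟨X, mk_X, i, X_one, i_self, i_unit_tensor, i_tensor_unit⟩ := σ
  have key : ∀ (I : C) (hI : I = 𝟙_ C) (h1 : Pi0.mk (X s ⊗ I) = s) (e : I ≅ 𝟙_ C)
      (_ : e = eqToIso hI),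
      (i (X s ⊗ I) h1).hom ≫ X s ◁ e.hom ≫ (ρ_ (X s)).hom = 𝟙 (X s) := by
    rintro I rfl h1 e rfl
    rw [i_tensor_unit]
    simp
  refine key (X 1) X_one _ _ ?_
  have key2 : ∀ (I : C) (hI : X 1 = I) (h : Pi0.mk I = 1), i I h = eqToIso hI := by
    rintro I rfl h
    exact i_self 1 h
  exact key2 _ X_one _

/-- The structure of the reduced category corresponds under `H` to that of `C`, through
`i_{X_s ⊗ X_t}⁻¹ : H(s) ⊗ H(t) → H(st)`. -/
def Reduced.inducingData (σ : Stick C) : Monoidal.InducingFunctorData (Reduced.H σ) where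
  μIso s t := (σ.iTensor s.cls t.cls rfl).symm
  εIso := (σ.i (s := 1) (𝟙_ C) rfl).symm
  tensorHom_eq f g :=
    ((Iso.eq_comp_inv _).2 (Reduced.H_tensorHom f g)).trans (Category.assoc _ _ _)
  whiskerLeft_eq s {_ _} g :=
    ((Iso.eq_comp_inv _).2 (Reduced.H_whiskerLeft s g)).trans (Category.assoc _ _ _)
  whiskerRight_eq {_ _} f t :=
    ((Iso.eq_comp_inv _).2 (Reduced.H_whiskerRight f t)).trans (Category.assoc _ _ _)
  associator_eq r s t := by
    have h := (Reduced.H_assoc_inv r s t).trans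
      (inv_aux (σ.iTensor r.cls (s.cls * t.cls) rfl) (σ.iTensor s.cls t.cls rfl)
        (σ.iTensor r.cls s.cls rfl) (σ.iTensor (r.cls * s.cls) t.cls rfl)).symm
    exact congrArg Iso.hom (Iso.ext_inv h : (Reduced.H σ).mapIso (α_ r s t) = _)
  leftUnitor_eq s := by
    have h := Stick.iTensor_hom σ rfl (one_mul s.cls) rfl rfl (one_mul s.cls).symm
    have h' := Stick.unit_tensor σ s.cls
    have h1 : (Reduced.H σ).map (λ_ s).hom = 𝟙 _ ≫ eqToHom (congrArg σ.X (one_mul s.cls)) :=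
      congrArg (fun m => m ≫ eqToHom (congrArg σ.X (one_mul s.cls)))
        (congrArg Iso.hom (map_one (gamma (σ.X (1 * s.cls)))))
    rw [h1]
    exact left_aux _ _ _ _ h h'
  rightUnitor_eq s := by
    have h := Stick.iTensor_hom σ rfl (mul_one s.cls) rfl rfl (mul_one s.cls).symm
    have h' := Stick.tensor_unit σ s.cls
    have h1 : (Reduced.H σ).map (ρ_ s).hom = 𝟙 _ ≫ eqToHom (congrArg σ.X (mul_one s.cls)) :=
      congrArg (fun m => m ≫ eqToHom (congrArg σ.X (mul_one s.cls)))
        (congrArg Iso.hom (map_one (gamma (σ.X (s.cls * 1)))))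
    rw [h1]
    exact right_aux _ _ _ _ h h'

instance : MonoidalCategory (Reduced σ) :=
  Monoidal.induced (Reduced.H σ) (Reduced.inducingData σ)

instance : (Reduced.H σ).Monoidal :=
  Monoidal.fromInducedMonoidal (Reduced.H σ) (Reduced.inducingData σ)

/-- The functor `H` is an equivalence of categories. -/
instance : (Reduced.H σ).IsEquivalence where
  full := ⟨fun {s t} g => by
    obtain ⟨s⟩ := s
    obtain ⟨t⟩ := t
    have hg : @IsIso C _ (σ.X s) (σ.X t) g := IsGrCategory.isIso (C := C) g
    have h : s = t := by
      rw [← σ.mk_X s, ← σ.mk_X t]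
      exact Pi0.sound (@asIso C _ (σ.X s) (σ.X t) g hg)
    subst h
    obtain ⟨u, hu⟩ := (gamma_bijective (σ.X s)).2 (@asIso C _ (σ.X s) (σ.X s) g hg)
    refine ⟨(⟨rfl, Additive.ofMul u⟩ : Reduced.Hom _ _), ?_⟩
    exact (Category.comp_id _).trans (congrArg Iso.hom hu)⟩
  essSurj := ⟨fun Y => ⟨⟨Pi0.mk Y⟩, ⟨σ.i Y rfl⟩⟩⟩

/-- The reduced category is a Gr-category. -/
instance : IsGrCategory (Reduced σ) where
  isIso f := (Reduced.mkIso f.eq f.val).isIso_hom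
  exists_inv s := ⟨⟨s.cls⁻¹⟩, ⟨Reduced.mkIso (mul_inv_cancel s.cls) 0⟩,
    ⟨Reduced.mkIso (inv_mul_cancel s.cls) 0⟩⟩

variable (σ) in
/-- The associativity constraint `r(st) → (rs)t` of the reduced Gr-category, as a function `h`
with values in `π₁`: the constraint is the morphism `(rst, h(r,s,t))`. -/
def Reduced.assocCochain (r s t : Pi0 C) : Pi1 C :=
  Reduced.Hom.val (α_ (⟨r⟩ : Reduced σ) ⟨s⟩ ⟨t⟩).inv

variable (σ) in
/-- The inverse constraint `(rs)t → r(st)` of the reduced Gr-category, likewise as a function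
with values in `π₁`. -/
def Reduced.assocInvCochain (r s t : Pi0 C) : Pi1 C :=
  Reduced.Hom.val (α_ (⟨r⟩ : Reduced σ) ⟨s⟩ ⟨t⟩).hom

/-- A strict Gr-category has a stick. -/
theorem Stick.nonempty_of_isStrict [IsStrict C] : Nonempty (Stick C) := by
  classical
  have hX : ∃ X : Pi0 C → C, X 1 = 𝟙_ C ∧ ∀ s, Pi0.mk (X s) = s := by
    have h : ∀ s : Pi0 C, ∃ Y : C, Pi0.mk Y = s := Pi0.ind fun Y => ⟨Y, rfl⟩
    choose X hX using h
    refine ⟨fun s => if s = 1 then 𝟙_ C else X s, if_pos rfl, fun s => ?_⟩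
    by_cases hs : s = 1
    · simp only [hs]
      rfl
    · simp only [if_neg hs, hX]
  obtain ⟨X, h1, hX⟩ := hX
  have hi : ∀ {s : Pi0 C} (Y : C), Pi0.mk Y = s → Nonempty (X s ≅ Y) :=
    fun {s} Y h => Pi0.mk_eq_iff.1 ((hX s).trans h.symm)
  refine ⟨⟨X, hX, fun {s} Y h => if e : X s = Y then eqToIso e else (hi Y h).some, h1, ?_, ?_, ?_⟩⟩
  · intro s h
    simp
  · intro s h
    have e : X s = 𝟙_ C ⊗ X s := (IsStrict.unit_tensor _).symm
    simp only [dif_pos e, IsStrict.leftUnitor_eq]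
    rfl
  · intro s h
    have e : X s = X s ⊗ 𝟙_ C := (IsStrict.tensor_unit _).symm
    simp only [dif_pos e, IsStrict.rightUnitor_eq]
    rfl

end Reduced

/-! ### The third cohomology group of a group -/

section Cohomology

variable {P : Type u} [Group P] {A : Type v} [AddCommGroup A]

/-- The differential of the inhomogeneous cochain complex from degree 2 to degree 3, for the
`P`-module structure on `A` given by `ρ`. -/
def d₂ (ρ : P →* AddMonoid.End A) : (P → P → A) →+ (P → P → P → A) where
  toFun g x y z := ρ x (g y z) - g (x * y) z + g x (y * z) - g x y
  map_zero' := by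
    funext x y z
    simp
  map_add' f g := by
    funext x y z
    simp only [Pi.add_apply, map_add]
    abel

/-- The differential of the inhomogeneous cochain complex from degree 3 to degree 4. -/
def d₃ (ρ : P →* AddMonoid.End A) : (P → P → P → A) →+ (P → P → P → P → A) where
  toFun k w x y z :=
    ρ w (k x y z) - k (w * x) y z + k w (x * y) z - k w x (y * z) + k w x y
  map_zero' := by
    funext w x y z
    simp
  map_add' f g := by
    funext w x y z
    simp only [Pi.add_apply, map_add]
    abel

/-- The group `Z³(P, A)` of 3-cocycles. -/
def Z3 (ρ : P →* AddMonoid.End A) : AddSubgroup (P → P → P → A) := (d₃ ρ).ker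

/-- The group `B³(P, A)` of 3-coboundaries. -/
def B3 (ρ : P →* AddMonoid.End A) : AddSubgroup (P → P → P → A) := (d₂ ρ).range

/-- The group `H³(P, A)`, for a group and a module in arbitrary universes. -/
abbrev H3 (ρ : P →* AddMonoid.End A) : Type (max u v) := Z3 ρ ⧸ (B3 ρ).addSubgroupOf (Z3 ρ)

/-- The cohomology class of a 3-cocycle. -/
def H3.mk {ρ : P →* AddMonoid.End A} (k : P → P → P → A) (hk : k ∈ Z3 ρ) : H3 ρ :=
  QuotientAddGroup.mk ⟨k, hk⟩

/-- A 3-cochain is normalized if it vanishes as soon as one argument is the identity. -/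
def IsNormalized (k : P → P → P → A) : Prop :=
  ∀ x y, k 1 x y = 0 ∧ k x 1 y = 0 ∧ k x y 1 = 0

/-- The 3-cochain `(x, y, z) ↦ e (h (q x, q y, q z))` obtained from `h` by pullback along `q` and
change of coefficients along `e`. -/
def pullback {Q B : Type*} [AddCommGroup B] (q : P → Q) (e : B → A) (h : Q → Q → Q → B) :
    P → P → P → A :=
  fun x y z => e (h (q x) (q y) (q z))

end Cohomology

/-! ### Abstract kernels -/

section AbstractKernel

/-- The group `In G` of inner automorphisms of `G`. -/
abbrev InnAut (G : Type v) [Group G] : Subgroup (MulAut G) :=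
  (MulAut.conj : G →* MulAut G).range

instance (G : Type v) [Group G] : (InnAut G).Normal where
  conj_mem := by
    rintro _ ⟨c, rfl⟩ α
    refine ⟨α c, ?_⟩
    ext a
    simp [MulAut.conj_apply]

/-- The group `Aut G / In G`. -/
abbrev OutAut (G : Type v) [Group G] : Type v := MulAut G ⧸ InnAut G

instance (G : Type v) [Group G] : CommGroup (Subgroup.center G) where
  mul_comm a b := Subtype.ext (b.2.comm a).symm

/-- The centre `ZG`, written additively. -/
abbrev Cen (G : Type v) [Group G] : Type v := Additive (Subgroup.center G)

variable {P : Type u} [Group P] {G : Type v} [Group G]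

/-- The restriction of automorphisms of `G` to the centre. -/
def centerAction (G : Type v) [Group G] : MulAut G →* AddMonoid.End (Cen G) where
  toFun α := MonoidHom.toAdditive (Subgroup.centerCongr α).toMonoidHom
  map_one' := rfl
  map_mul' _ _ := rfl

/-- The action of `Aut G / In G` on the centre of `G`. -/
def outAction (G : Type v) [Group G] : OutAut G →* AddMonoid.End (Cen G) :=
  QuotientGroup.lift (InnAut G) (centerAction G) (by
    rintro _ ⟨c, rfl⟩
    refine AddMonoidHom.ext fun a => Additive.toMul.injective (Subtype.ext ?_)
    change c * (a.toMul : G) * c⁻¹ = (a.toMul : G)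
    rw [Subgroup.mem_center_iff.1 a.toMul.2 c, mul_inv_cancel_right])

/-- The `P`-module structure on the centre of `G` given by an abstract kernel `ψ`. -/
def kernelAction (ψ : P →* OutAut G) : P →* AddMonoid.End (Cen G) := (outAction G).comp ψ

/-- A factor set `(φ, f)` of an abstract kernel `ψ`: representatives `φ(x) ∈ ψ(x)` with
`φ(1) = id`, and `f : P² → G` with `φ(x) φ(y) = μ_{f(x,y)} φ(xy)`. -/
structure FactorSet (ψ : P →* OutAut G) where
  φ : P → MulAut G
  f : P → P → G
  mk_φ : ∀ x, (φ x : OutAut G) = ψ x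
  φ_one : φ 1 = 1
  φ_mul : ∀ x y, φ x * φ y = MulAut.conj (f x y) * φ (x * y)

theorem FactorSet.nonempty (ψ : P →* OutAut G) : Nonempty (FactorSet ψ) := by
  classical
  have h : ∀ x, ∃ α : MulAut G, (α : OutAut G) = ψ x := fun x => QuotientGroup.mk_surjective _
  choose φ₀ hφ₀ using h
  obtain ⟨φ, hφ, hone⟩ : ∃ φ : P → MulAut G, (∀ x, (φ x : OutAut G) = ψ x) ∧ φ 1 = 1 := by
    refine ⟨fun x => if x = 1 then 1 else φ₀ x, fun x => ?_, if_pos rfl⟩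
    by_cases hx : x = 1
    · simp [hx]
    · simp [hx, hφ₀]
  have h2 : ∀ x y, ∃ c : G, MulAut.conj c = φ x * φ y * (φ (x * y))⁻¹ := by
    intro x y
    have : φ x * φ y * (φ (x * y))⁻¹ ∈ InnAut G := by
      rw [← QuotientGroup.eq_one_iff, QuotientGroup.mk_mul, QuotientGroup.mk_mul,
        QuotientGroup.mk_inv, hφ, hφ, hφ, map_mul, mul_inv_cancel]
    exact this
  choose f hf using h2
  exact ⟨⟨φ, f, hφ, hone, fun x y => by rw [hf, inv_mul_cancel_right]⟩⟩

theorem conj_eq_conj_iff {a b : G} (h : MulAut.conj a = MulAut.conj b) :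
    a * b⁻¹ ∈ Subgroup.center G := by
  rw [Subgroup.mem_center_iff]
  intro c
  have := DFunLike.congr_fun h (b⁻¹ * c * b)
  simp only [MulAut.conj_apply] at this
  have h2 : a * b⁻¹ * c = c * (a * b⁻¹) := by
    have h3 : a * (b⁻¹ * c * b) * a⁻¹ = c := by rw [this]; group
    calc a * b⁻¹ * c = (a * (b⁻¹ * c * b) * a⁻¹) * (a * b⁻¹) := by group
      _ = c * (a * b⁻¹) := by rw [h3]
  exact h2.symm

/-- The cochain `k : P³ → ZG` determined by
`φ(x)(f(y,z)) f(x,yz) = k(x,y,z) f(x,y) f(xy,z)`; its class is the obstruction of the kernel. -/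
def FactorSet.obstruction {ψ : P →* OutAut G} (F : FactorSet ψ) (x y z : P) : Cen G :=
  Additive.ofMul ⟨F.φ x (F.f y z) * F.f x (y * z) * (F.f x y * F.f (x * y) z)⁻¹, by
    apply conj_eq_conj_iff
    have h1 : MulAut.conj (F.φ x (F.f y z)) * F.φ x = F.φ x * MulAut.conj (F.f y z) := by
      ext a
      simp [MulAut.conj_apply]
    apply mul_right_cancel (b := F.φ (x * y * z))
    calc MulAut.conj (F.φ x (F.f y z) * F.f x (y * z)) * F.φ (x * y * z)
        = MulAut.conj (F.φ x (F.f y z)) * (F.φ x * F.φ (y * z)) := by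
          rw [F.φ_mul, map_mul, mul_assoc, mul_assoc]
      _ = F.φ x * (F.φ y * F.φ z) := by
          rw [← mul_assoc, h1, mul_assoc, ← F.φ_mul]
      _ = MulAut.conj (F.f x y) * (F.φ (x * y) * F.φ z) := by
          rw [← mul_assoc, F.φ_mul, mul_assoc]
      _ = MulAut.conj (F.f x y * F.f (x * y) z) * F.φ (x * y * z) := by
          rw [F.φ_mul, map_mul, mul_assoc (MulAut.conj _)]⟩

theorem FactorSet.obstruction_spec {ψ : P →* OutAut G} (F : FactorSet ψ) (x y z : P) :
    F.φ x (F.f y z) * F.f x (y * z) =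
      ((F.obstruction x y z).toMul : G) * (F.f x y * F.f (x * y) z) :=
  (inv_mul_cancel_right _ _).symm

end AbstractKernel

/-! ### The strict Gr-category of automorphisms of a group -/

section AutCat

/-- The objects of the category `Aut_G`: the automorphisms of `G`. -/
@[ext]
structure AutCat (G : Type v) [Group G] : Type v where
  aut : MulAut G

variable {G : Type v} [Group G]

/-- The morphisms `α → β` of `Aut_G`: the elements `c` of `G` with `α = μ_c ∘ β`. -/
@[ext]
structure AutCat.Hom (α β : AutCat G) : Type v where
  elt : G
  eq : α.aut = MulAut.conj elt * β.aut

/-- The composite of `c : α → β` and `d : β → γ` is `cd` (the sum `c + d` in additive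
notation). -/
instance : Category (AutCat G) where
  Hom α β := AutCat.Hom α β
  id α := ⟨1, by rw [map_one, one_mul]⟩
  comp c d := ⟨c.elt * d.elt, by rw [map_mul, mul_assoc, ← d.eq, ← c.eq]⟩
  id_comp c := AutCat.Hom.ext (one_mul c.elt)
  comp_id c := AutCat.Hom.ext (mul_one c.elt)
  assoc c d e := AutCat.Hom.ext (mul_assoc c.elt d.elt e.elt)

theorem AutCat.hom_ext {α β : AutCat G} {c d : α ⟶ β} (h : c.elt = d.elt) : c = d :=
  AutCat.Hom.ext h

/-- An element of `G` regarded as an isomorphism of `Aut_G`. -/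
def AutCat.mkIso {α β : AutCat G} (c : G) (h : α.aut = MulAut.conj c * β.aut) : α ≅ β where
  hom := ⟨c, h⟩
  inv := ⟨c⁻¹, by rw [h, ← mul_assoc, ← map_mul, inv_mul_cancel, map_one, one_mul]⟩
  hom_inv_id := AutCat.hom_ext (mul_inv_cancel c)
  inv_hom_id := AutCat.hom_ext (inv_mul_cancel c)

/-- The tensor product of `c : α → α'` and `d : β → β'` is `c α'(d) : αβ → α'β'`
(`c + α' d` in additive notation); the constraints are given by the neutral element. -/
instance : MonoidalCategoryStruct (AutCat G) where
  tensorObj α β := ⟨α.aut * β.aut⟩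
  tensorUnit := ⟨1⟩
  tensorHom {α α' β β'} c d := ⟨c.elt * α'.aut d.elt, by
    rw [c.eq, d.eq]
    ext a
    simp [MulAut.conj_apply]⟩
  whiskerLeft α {β β'} d := ⟨α.aut d.elt, by
    rw [d.eq]
    ext a
    simp [MulAut.conj_apply]⟩
  whiskerRight {α α'} c β := ⟨c.elt, by rw [c.eq, mul_assoc]⟩
  associator α β γ := AutCat.mkIso 1 (by rw [map_one, one_mul, mul_assoc])
  leftUnitor α := AutCat.mkIso 1 (by rw [map_one, one_mul])
  rightUnitor α := AutCat.mkIso 1 (by rw [map_one, one_mul]; exact mul_one α.aut)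

instance : MonoidalCategory (AutCat G) where
  tensorHom_def {α α' β β'} c d := AutCat.hom_ext rfl
  id_tensorHom_id α β := AutCat.hom_ext (by
    change 1 * α.aut 1 = (1 : G)
    rw [map_one, one_mul])
  tensorHom_comp_tensorHom {α α' α'' β β' β''} c d c' d' := AutCat.hom_ext (by
    change c.elt * α'.aut d.elt * (c'.elt * α''.aut d'.elt) =
      c.elt * c'.elt * α''.aut (d.elt * d'.elt)
    rw [c'.eq]
    simp [MulAut.conj_apply, mul_assoc])
  whiskerLeft_id α β := AutCat.hom_ext (map_one α.aut)
  id_whiskerRight α β := AutCat.hom_ext rfl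
  associator_naturality {α₁ α₂ α₃ β₁ β₂ β₃} c d e := AutCat.hom_ext (by
    change c.elt * β₁.aut d.elt * β₁.aut (β₂.aut e.elt) * 1 =
      1 * (c.elt * β₁.aut (d.elt * β₂.aut e.elt))
    rw [mul_one, one_mul, map_mul, mul_assoc])
  leftUnitor_naturality {α β} c := AutCat.hom_ext (by
    change c.elt * 1 = 1 * c.elt
    rw [mul_one, one_mul])
  rightUnitor_naturality {α β} c := AutCat.hom_ext (by
    change c.elt * 1 = 1 * c.elt
    rw [mul_one, one_mul])
  pentagon α β γ δ := AutCat.hom_ext (by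
    change 1 * (1 * α.aut 1) = (1 * 1 : G)
    rw [map_one, one_mul])
  triangle α β := AutCat.hom_ext (by
    change 1 * α.aut 1 = (1 : G)
    rw [map_one, one_mul])

instance : IsGrCategory (AutCat G) where
  isIso c := (AutCat.mkIso c.elt c.eq).isIso_hom
  exists_inv α := ⟨⟨α.aut⁻¹⟩,
    ⟨AutCat.mkIso 1 (by rw [map_one, one_mul]; exact mul_inv_cancel α.aut)⟩,
    ⟨AutCat.mkIso 1 (by rw [map_one, one_mul]; exact inv_mul_cancel α.aut)⟩⟩

theorem AutCat.mkIso_eq_eqToIso {α β : AutCat G} (h : α.aut = MulAut.conj 1 * β.aut)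
    (h' : α = β) : AutCat.mkIso 1 h = eqToIso h' := by
  subst h'
  exact Iso.ext (AutCat.hom_ext rfl)

/-- The Gr-category `Aut_G` is strict. -/
instance : IsStrict (AutCat G) where
  assoc_obj _ _ _ := rfl
  unit_tensor _ := rfl
  tensor_unit _ := rfl
  associator_eq _ _ _ := AutCat.mkIso_eq_eqToIso _ _
  leftUnitor_eq _ := AutCat.mkIso_eq_eqToIso _ _
  rightUnitor_eq _ := AutCat.mkIso_eq_eqToIso _ _

/-- The element of `G` underlying an automorphism of the unit object of `Aut_G`. -/
def AutCat.unitElt (u : Pi1 (AutCat G)) : G := AutCat.Hom.elt u.toMul.hom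

end AutCat

end GrCat

end

noncomputable section

namespace GrCat

/-! ### Factor sets and the obstruction cocycle -/

section AbstractKernel

variable {P : Type u} [Group P] {G : Type v} [Group G]

/-! A stick of `Aut_G` is already a factor set. Its isomorphism `X_s ⊗ X_t → X_{st}` is an element
`m(s,t)` of `G`, and being a morphism of `Aut_G` means precisely `X_s X_t = μ_{m(s,t)} X_{st}`
(`Stick.X_aut_mul`). Since the associator of `Aut_G` is carried by the neutral element, the
transported constraint can be read off in `G` (`Reduced.unitElt_assocCochain`), multiplicatively:
`h(r,s,t) = m(r,st)⁻¹ · X_r(m(s,t))⁻¹ · m(r,s) · m(rs,t)`. Pulled back along `ψ`, this is the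
negative of the obstruction cochain of the factor set defined by the stick, as an equality of
cochains (`Stick.pullback_assocCochain`). The sign comes from the direction `r(st) → (rs)t` of the
constraint.

What remains is the classical theory of abstract kernels: an obstruction cochain is a cocycle
(`FactorSet.obstruction_mem_Z3`), and another choice of factor set changes it by a coboundary
(`FactorSet.obstruction_sub_mem_B3`). That `h` itself is a cocycle follows from the same theory,
applied to the tautological kernel `π₀(Aut_G) ≅ Aut G / In G`, without using the pentagon. -/

theorem Cen.comm (k : Cen G) (a : G) : a * (k.toMul : G) = (k.toMul : G) * a :=
  Subgroup.mem_center_iff.1 k.toMul.2 a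

theorem Cen.left_comm (k : Cen G) (a b : G) :
    a * ((k.toMul : G) * b) = (k.toMul : G) * (a * b) := by
  rw [← mul_assoc, Cen.comm, mul_assoc]

theorem Cen.coe_add (k l : Cen G) : ((k + l).toMul : G) = (k.toMul : G) * (l.toMul : G) := rfl

theorem Cen.coe_injective {k l : Cen G} (h : (k.toMul : G) = (l.toMul : G)) : k = l :=
  Additive.toMul.injective (Subtype.ext h)

theorem coe_outAction (α : MulAut G) (k : Cen G) :
    ((outAction G (α : OutAut G) k).toMul : G) = α (k.toMul : G) := rfl

/-- The inner factor is put on the left, as in the morphisms of `Aut_G`, so that the same criterion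
compares both isomorphism classes of objects and representatives of an abstract kernel. -/
theorem OutAut.mk_eq_mk_iff {α β : MulAut G} :
    (α : OutAut G) = (β : OutAut G) ↔ ∃ c : G, α = MulAut.conj c * β := by
  constructor
  · intro h
    have h1 : ((α * β⁻¹ : MulAut G) : OutAut G) = 1 := by
      rw [QuotientGroup.mk_mul, QuotientGroup.mk_inv, h, mul_inv_cancel]
    obtain ⟨c, hc⟩ := (QuotientGroup.eq_one_iff _).1 h1
    exact ⟨c, by rw [hc, inv_mul_cancel_right]⟩
  · rintro ⟨c, rfl⟩
    have h1 : ((MulAut.conj c : MulAut G) : OutAut G) = 1 :=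
      (QuotientGroup.eq_one_iff _).2 ⟨c, rfl⟩
    rw [QuotientGroup.mk_mul, h1, one_mul]

variable {ψ : P →* OutAut G}

theorem FactorSet.coe_kernelAction (F : FactorSet ψ) (x : P) (k : Cen G) :
    ((kernelAction ψ x k).toMul : G) = F.φ x (k.toMul : G) := by
  change ((outAction G (ψ x) k).toMul : G) = _
  rw [← F.mk_φ x, coe_outAction]

theorem FactorSet.φ_φ_mul (F : FactorSet ψ) (x y : P) (a : G) :
    F.φ x (F.φ y a) * F.f x y = F.f x y * F.φ (x * y) a := by
  have h := DFunLike.congr_fun (F.φ_mul x y) a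
  simp only [MulAut.mul_apply, MulAut.conj_apply] at h
  rw [h, inv_mul_cancel_right]

/-- The obstruction cochain of an abstract kernel is a cocycle. -/
theorem FactorSet.obstruction_mem_Z3 (F : FactorSet ψ) :
    F.obstruction ∈ Z3 (kernelAction ψ) := by
  refine AddMonoidHom.mem_ker.2 ?_
  funext w x y z
  have key : kernelAction ψ w (F.obstruction x y z) + F.obstruction w (x * y) z +
      F.obstruction w x y = F.obstruction w x (y * z) + F.obstruction (w * x) y z := by
    apply Cen.coe_injective
    simp only [Cen.coe_add, F.coe_kernelAction]
    refine mul_right_cancel (b := F.f w x * F.f (w * x) y * F.f (w * x * y) z) ?_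
    have h1 : F.φ w (F.φ x (F.f y z) * F.f x (y * z)) * F.f w (x * y * z) =
        F.φ w ((F.obstruction x y z).toMul : G) *
          ((F.obstruction w (x * y) z).toMul : G) * ((F.obstruction w x y).toMul : G) *
          (F.f w x * F.f (w * x) y * F.f (w * x * y) z) := by
      rw [F.obstruction_spec, map_mul, map_mul, mul_assoc, mul_assoc, mul_assoc x y z,
        ← mul_assoc x y z, F.obstruction_spec w (x * y) z, Cen.left_comm, ← mul_assoc w x y,
        ← mul_assoc (F.φ w (F.f x y)), F.obstruction_spec w x y]
      simp only [mul_assoc]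
    have h2 : F.φ w (F.φ x (F.f y z) * F.f x (y * z)) * F.f w (x * y * z) =
        ((F.obstruction w x (y * z)).toMul : G) * ((F.obstruction (w * x) y z).toMul : G) *
          (F.f w x * F.f (w * x) y * F.f (w * x * y) z) := by
      -- Here `φ_w φ_x` is replaced by `μ_{f(w,x)} φ_{wx}`, which moves `f(w,x)` to the left of the
      -- image of `f(y,z)` and prepares the use of `k(wx,y,z)`.
      rw [map_mul, mul_assoc, mul_assoc x y z, F.obstruction_spec w x (y * z), Cen.left_comm,
        ← mul_assoc (F.φ w (F.φ x (F.f y z))), F.φ_φ_mul, mul_assoc (F.f w x),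
        F.obstruction_spec (w * x) y z, Cen.left_comm]
      simp only [mul_assoc]
    exact h1.symm.trans h2
  change kernelAction ψ w (F.obstruction x y z) - F.obstruction (w * x) y z +
    F.obstruction w (x * y) z - F.obstruction w x (y * z) + F.obstruction w x y = 0
  rw [← sub_eq_zero] at key
  rw [← key]
  abel

/-- The obstruction cochains of two factor sets of the same abstract kernel differ by a
coboundary. -/
theorem FactorSet.obstruction_sub_mem_B3 (F F' : FactorSet ψ) :
    F'.obstruction - F.obstruction ∈ B3 (kernelAction ψ) := by
  have hb : ∀ x, ∃ b : G, F'.φ x = MulAut.conj b * F.φ x := fun x =>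
    OutAut.mk_eq_mk_iff.1 ((F'.mk_φ x).trans (F.mk_φ x).symm)
  choose b hb using hb
  have hb' : ∀ x a, F'.φ x a * b x = b x * F.φ x a := fun x a => by
    rw [hb]
    simp [MulAut.conj_apply]
  have hz : ∀ x y, ∃ c : Cen G,
      F'.f x y * b (x * y) = (c.toMul : G) * (b x * F.φ x (b y) * F.f x y) := by
    intro x y
    refine ⟨Additive.ofMul ⟨_, conj_eq_conj_iff (a := F'.f x y * b (x * y))
      (b := b x * F.φ x (b y) * F.f x y) ?_⟩, (inv_mul_cancel_right _ _).symm⟩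
    apply mul_right_cancel (b := F.φ (x * y))
    have h1 : MulAut.conj (F.φ x (b y)) * F.φ x = F.φ x * MulAut.conj (b y) := by
      ext a
      simp [MulAut.conj_apply]
    calc MulAut.conj (F'.f x y * b (x * y)) * F.φ (x * y)
        = F'.φ x * F'.φ y := by rw [map_mul, mul_assoc, ← hb, ← F'.φ_mul]
      _ = MulAut.conj (b x) * (F.φ x * MulAut.conj (b y)) * F.φ y := by
          rw [hb, hb]; simp only [mul_assoc]
      _ = MulAut.conj (b x * F.φ x (b y) * F.f x y) * F.φ (x * y) := by
          rw [← h1, map_mul, map_mul]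
          simp only [mul_assoc]
          rw [F.φ_mul]
  choose c hc using hz
  refine ⟨c, ?_⟩
  funext x y z
  have key : kernelAction ψ x (c y z) + c x (y * z) + F.obstruction x y z =
      F'.obstruction x y z + c (x * y) z + c x y := by
    apply Cen.coe_injective
    simp only [Cen.coe_add]
    -- As in the cocycle identity, one element, `φ'_x(f'(y,z)) f'(x,yz) b(xyz)`, is reduced in two
    -- ways to a central element times this product, which involves only `b`, `φ` and `f`.
    refine mul_right_cancel
      (b := b x * F.φ x (b y) * F.f x y * F.φ (x * y) (b z) * F.f (x * y) z) ?_
    have h1 : F'.φ x (F'.f y z) * F'.f x (y * z) * b (x * (y * z)) =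
        ((kernelAction ψ x (c y z)).toMul : G) * ((c x (y * z)).toMul : G) *
          ((F.obstruction x y z).toMul : G) *
          (b x * F.φ x (b y) * F.f x y * F.φ (x * y) (b z) * F.f (x * y) z) := by
      calc F'.φ x (F'.f y z) * F'.f x (y * z) * b (x * (y * z))
          = ((c x (y * z)).toMul : G) * (b x * F.φ x (F'.f y z * b (y * z)) * F.f x (y * z)) := by
            rw [mul_assoc, hc, Cen.left_comm, map_mul (F.φ x)]
            simp only [mul_assoc]
            rw [← mul_assoc (F'.φ x (F'.f y z)), hb', mul_assoc]
        _ = ((c x (y * z)).toMul : G) * (b x * (((kernelAction ψ x (c y z)).toMul : G) *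
              (F.φ x (b y) * (F.φ x (F.φ y (b z)) * (F.φ x (F.f y z) * F.f x (y * z)))))) := by
            rw [hc, map_mul, ← F.coe_kernelAction, map_mul, map_mul]
            simp only [mul_assoc]
        _ = ((c x (y * z)).toMul : G) * (((kernelAction ψ x (c y z)).toMul : G) *
              (((F.obstruction x y z).toMul : G) * (b x * (F.φ x (b y) *
                (F.φ x (F.φ y (b z)) * F.f x y * F.f (x * y) z))))) := by
            rw [F.obstruction_spec, Cen.left_comm, Cen.left_comm _ (F.φ x (F.φ y (b z))),
              Cen.left_comm _ (F.φ x (b y)), Cen.left_comm _ (b x)]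
            simp only [mul_assoc]
        _ = _ := by
            rw [F.φ_φ_mul, Cen.left_comm]
            simp only [mul_assoc]
    have h2 : F'.φ x (F'.f y z) * F'.f x (y * z) * b (x * (y * z)) =
        ((F'.obstruction x y z).toMul : G) * ((c (x * y) z).toMul : G) * ((c x y).toMul : G) *
          (b x * F.φ x (b y) * F.f x y * F.φ (x * y) (b z) * F.f (x * y) z) := by
      calc F'.φ x (F'.f y z) * F'.f x (y * z) * b (x * (y * z))
          = ((F'.obstruction x y z).toMul : G) *
              (F'.f x y * (F'.f (x * y) z * b (x * y * z))) := by
            rw [F'.obstruction_spec, ← mul_assoc x y z]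
            simp only [mul_assoc]
        _ = ((F'.obstruction x y z).toMul : G) * (((c (x * y) z).toMul : G) *
              (F'.f x y * b (x * y) * (F.φ (x * y) (b z) * F.f (x * y) z))) := by
            rw [hc (x * y), Cen.left_comm]
            simp only [mul_assoc]
        _ = _ := by
            rw [hc x y]
            simp only [mul_assoc]
    exact h1.symm.trans h2
  change kernelAction ψ x (c y z) - c (x * y) z + c x (y * z) - c x y =
    F'.obstruction x y z - F.obstruction x y z
  rw [← sub_eq_zero] at key ⊢
  rw [← key]
  abel

end AbstractKernel

/-! ### Equality and negation of classes in `H³` -/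

section Cohomology

variable {P : Type u} [Group P] {A : Type v} [AddCommGroup A] {ρ : P →* AddMonoid.End A}

theorem H3.mk_eq_mk {k l : P → P → P → A} (hk : k ∈ Z3 ρ) (hl : l ∈ Z3 ρ) (h : l - k ∈ B3 ρ) :
    H3.mk k hk = H3.mk l hl := by
  refine QuotientAddGroup.eq.2 (AddSubgroup.mem_addSubgroupOf.2 ?_)
  change -k + l ∈ B3 ρ
  rwa [neg_add_eq_sub]

theorem H3.mk_neg {k : P → P → P → A} (hk : k ∈ Z3 ρ) (hk' : -k ∈ Z3 ρ) :
    H3.mk (-k) hk' = -H3.mk k hk := rfl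

end Cohomology

/-! ### The invariants `π₀` and `π₁` of `Aut_G` -/

section AutCat

variable {G : Type v} [Group G]

theorem AutCat.inv_elt {α β : AutCat G} (e : α ≅ β) : e.inv.elt = (e.hom.elt)⁻¹ :=
  (inv_eq_of_mul_eq_one_right (congrArg AutCat.Hom.elt e.hom_inv_id)).symm

/-- The unit constraints are carried by the neutral element and whiskering on the right keeps the
element, so `γ_α` is invisible in `G`. As `δ_α` applies `α`, the action `γ⁻¹δ` is evaluation of
automorphisms. -/
theorem AutCat.gamma_elt (α : AutCat G) (u : Aut (𝟙_ (AutCat G))) :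
    (gamma α u).hom.elt = u.hom.elt := by
  change (1 : G)⁻¹ * (u.hom.elt * 1) = _
  rw [inv_one, one_mul, mul_one]

theorem AutCat.delta_elt (α : AutCat G) (u : Aut (𝟙_ (AutCat G))) :
    (delta α u).hom.elt = α.aut u.hom.elt := by
  change (1 : G)⁻¹ * (α.aut u.hom.elt * 1) = _
  rw [inv_one, one_mul, mul_one]

/-- The unit object is the identity automorphism, so an endomorphism `c` of it satisfies `μ_c = id`.
-/
theorem AutCat.unitElt_mem_center (u : Pi1 (AutCat G)) :
    AutCat.unitElt u ∈ Subgroup.center G := by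
  have h : (1 : MulAut G) = MulAut.conj (AutCat.unitElt u) * 1 := u.toMul.hom.eq
  have h' : MulAut.conj (AutCat.unitElt u) = MulAut.conj 1 := by
    rw [map_one, ← mul_one (MulAut.conj _), ← h]
  simpa using conj_eq_conj_iff h'

/-- The isomorphism `π₁(Aut_G) ≅ ZG`. -/
def AutCat.pi1Equiv (G : Type v) [Group G] : Pi1 (AutCat G) ≃+ Cen G where
  toFun u := Additive.ofMul ⟨AutCat.unitElt u, AutCat.unitElt_mem_center u⟩
  invFun k := Additive.ofMul (AutCat.mkIso (k.toMul : G) (by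
    rw [show MulAut.conj (k.toMul : G) = 1 from ?_, one_mul]
    ext a
    rw [MulAut.conj_apply, ← Cen.comm, mul_inv_cancel_right]
    rfl))
  left_inv u := Additive.toMul.injective (Iso.ext (AutCat.hom_ext rfl))
  right_inv k := rfl
  -- Multiplication in `Aut` composes in the order opposite to `≫`, so the two factors appear
  -- exchanged; centrality restores the order.
  map_add' u w := Cen.coe_injective
    (Subgroup.mem_center_iff.1 (AutCat.unitElt_mem_center u) (AutCat.unitElt w))

theorem AutCat.coe_pi1Equiv (u : Pi1 (AutCat G)) :
    ((AutCat.pi1Equiv G u).toMul : G) = AutCat.unitElt u := rfl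

/-- The map `π₀(Aut_G) → Aut G / In G`. -/
def AutCat.pi0Map (G : Type v) [Group G] : Pi0 (AutCat G) → OutAut G :=
  Quotient.lift (fun α : AutCat G => (α.aut : OutAut G))
    fun _ _ ⟨e⟩ => OutAut.mk_eq_mk_iff.2 ⟨e.hom.elt, e.hom.eq⟩

/-- The isomorphism `π₀(Aut_G) ≅ Aut G / In G`. -/
def AutCat.pi0Equiv (G : Type v) [Group G] : Pi0 (AutCat G) ≃* OutAut G :=
  MulEquiv.ofBijective
    (MulHom.mk (AutCat.pi0Map G) (Pi0.ind fun _ => Pi0.ind fun _ => rfl))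
    ⟨by
      intro s t
      revert s t
      refine Pi0.ind fun α => Pi0.ind fun β => fun h => ?_
      obtain ⟨c, hc⟩ := OutAut.mk_eq_mk_iff.1 (h : (α.aut : OutAut G) = (β.aut : OutAut G))
      exact Pi0.sound (AutCat.mkIso c hc),
    fun q => by
      obtain ⟨α, rfl⟩ := QuotientGroup.mk_surjective q
      exact ⟨Pi0.mk ⟨α⟩, rfl⟩⟩

theorem AutCat.pi0Equiv_mk (α : AutCat G) :
    AutCat.pi0Equiv G (Pi0.mk α) = (α.aut : OutAut G) := rfl

theorem AutCat.pi1Equiv_smul (s : Pi0 (AutCat G)) (u : Pi1 (AutCat G)) :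
    AutCat.pi1Equiv G (s • u) =
      outAction G (AutCat.pi0Equiv G s) (AutCat.pi1Equiv G u) := by
  revert s
  refine Pi0.ind fun α => Cen.coe_injective ?_
  rw [AutCat.pi0Equiv_mk, coe_outAction, AutCat.coe_pi1Equiv, AutCat.coe_pi1Equiv]
  have h : (gamma α (Pi0.mk α • u).toMul).hom.elt = (delta α u.toMul).hom.elt :=
    congrArg (fun f : Aut α => f.hom.elt) (gamma_smul α u)
  rw [AutCat.gamma_elt, AutCat.delta_elt] at h
  exact h

end AutCat

/-! ### Sticks of `Aut_G` as factor sets -/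

section StickAut

variable {G : Type v} [Group G] (σ : Stick (AutCat G))

/-- The element of `G` given by `i_{X_s ⊗ X_t}⁻¹ : X_s ⊗ X_t → X_{st}`. -/
def Stick.mulElt (s t : Pi0 (AutCat G)) : G := (σ.iTensor s t rfl).inv.elt

/-- The underlying element does not see along which equality the source class is rewritten. This
disposes of the identification of `X_{r(st)}` with `X_{(rs)t}` in the constraint. -/
theorem Stick.iTensor_inv_elt {r s t : Pi0 (AutCat G)} (h : r = s * t) :
    (σ.iTensor s t h).inv.elt = σ.mulElt s t := by
  subst h
  rfl

theorem Stick.iTensor_hom_elt {r s t : Pi0 (AutCat G)} (h : r = s * t) :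
    (σ.iTensor s t h).hom.elt = (σ.mulElt s t)⁻¹ := by
  rw [← σ.iTensor_inv_elt h, AutCat.inv_elt, inv_inv]

theorem Stick.i_unit_elt : (σ.i (s := 1) (𝟙_ (AutCat G)) rfl).hom.elt = 1 := by
  -- The equality `X_1 = I` concerns objects; with a variable in place of the unit object it can be
  -- substituted, which reduces the claim to `i_{X_s} = id`.
  have key : ∀ (I : AutCat G) (hI : σ.X 1 = I) (h : Pi0.mk I = 1), (σ.i I h).hom.elt = 1 := by
    rintro I rfl h
    rw [σ.i_self]
    rfl
  exact key _ σ.X_one _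

theorem Stick.X_one_aut : (σ.X 1).aut = 1 := congrArg AutCat.aut σ.X_one

theorem Stick.mulElt_one_left (s : Pi0 (AutCat G)) : σ.mulElt 1 s = 1 := by
  have h : (σ.iTensor 1 s (one_mul s).symm).hom.elt *
      ((σ.i (s := 1) (𝟙_ (AutCat G)) rfl).hom.elt * 1) = 1 :=
    congrArg AutCat.Hom.elt (σ.unit_tensor s)
  rwa [σ.iTensor_hom_elt, σ.i_unit_elt, mul_one, mul_one, inv_eq_one] at h

theorem Stick.mulElt_one_right (s : Pi0 (AutCat G)) : σ.mulElt s 1 = 1 := by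
  have h : (σ.iTensor s 1 (mul_one s).symm).hom.elt *
      ((σ.X s).aut (σ.i (s := 1) (𝟙_ (AutCat G)) rfl).hom.elt * 1) = 1 :=
    congrArg AutCat.Hom.elt (σ.tensor_unit s)
  rwa [σ.iTensor_hom_elt, σ.i_unit_elt, map_one, mul_one, mul_one, inv_eq_one] at h

/-- This is the condition for `m(s,t)` to be a morphism `X_s ⊗ X_t → X_{st}`, and at the same time
the defining relation of a factor set. -/
theorem Stick.X_aut_mul (s t : Pi0 (AutCat G)) :
    (σ.X s).aut * (σ.X t).aut = MulAut.conj (σ.mulElt s t) * (σ.X (s * t)).aut :=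
  (σ.iTensor s t rfl).inv.eq

/-- Since `γ` preserves underlying elements, the value of `h` is the product in `G` of the five
factors of `assocAut`, in which the associator contributes the neutral element. -/
theorem Reduced.unitElt_assocCochain (r s t : Pi0 (AutCat G)) :
    AutCat.unitElt (Reduced.assocCochain σ r s t) =
      (σ.mulElt r (s * t))⁻¹ * ((σ.X r).aut (σ.mulElt s t)⁻¹ *
        (σ.mulElt r s * σ.mulElt (r * s) t)) := by
  have h : gamma _ (Reduced.assocCochain σ r s t).toMul = σ.assocAut r s t :=
    gamma_gammaEquiv_symm _ _
  have h' : (gamma _ (Reduced.assocCochain σ r s t).toMul).hom.elt = (σ.assocAut r s t).hom.elt :=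
    congrArg (fun f : Aut (σ.X (r * (s * t))) => f.hom.elt) h
  rw [AutCat.gamma_elt] at h'
  refine Eq.trans h' ?_
  change (σ.iTensor r (s * t) rfl).hom.elt * ((σ.X r).aut (σ.iTensor s t rfl).hom.elt *
    ((1 : G)⁻¹ * ((σ.iTensor r s rfl).inv.elt *
      (σ.iTensor (r * s) t (mul_assoc r s t).symm).inv.elt))) = _
  rw [σ.iTensor_hom_elt, σ.iTensor_hom_elt, σ.iTensor_inv_elt, σ.iTensor_inv_elt, inv_one,
    one_mul]

theorem Reduced.assocInvCochain_eq_neg {C : Type u} [Category.{v} C] [MonoidalCategory C]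
    [IsGrCategory C] (σ : Stick C) (r s t : Pi0 C) :
    Reduced.assocInvCochain σ r s t = -Reduced.assocCochain σ r s t :=
  eq_neg_of_add_eq_zero_left (congrArg Reduced.Hom.val
    (α_ (⟨r⟩ : Reduced σ) ⟨s⟩ ⟨t⟩).inv_hom_id)

theorem Reduced.isNormalized_assocCochain : IsNormalized (Reduced.assocCochain σ) := by
  have key : ∀ r s t, AutCat.unitElt (Reduced.assocCochain σ r s t) = 1 →
      Reduced.assocCochain σ r s t = 0 := fun r s t h =>
    (AutCat.pi1Equiv G).injective (Cen.coe_injective (h.trans rfl))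
  refine fun x y => ⟨key _ _ _ ?_, key _ _ _ ?_, key _ _ _ ?_⟩ <;>
  · rw [Reduced.unitElt_assocCochain]
    simp [Stick.mulElt_one_left, Stick.mulElt_one_right, Stick.X_one_aut]

variable {P : Type w} [Group P] (ψ : P →* OutAut G)

/-- The factor set of an abstract kernel given by a stick of `Aut_G`. -/
def Stick.factorSet : FactorSet ψ where
  φ x := (σ.X ((AutCat.pi0Equiv G).symm (ψ x))).aut
  f x y := σ.mulElt ((AutCat.pi0Equiv G).symm (ψ x)) ((AutCat.pi0Equiv G).symm (ψ y))
  mk_φ x := by rw [← AutCat.pi0Equiv_mk, σ.mk_X, MulEquiv.apply_symm_apply]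
  φ_one := by rw [map_one, map_one, σ.X_one_aut]
  φ_mul x y := by rw [map_mul, map_mul, σ.X_aut_mul]

/-- The two cochains cancel exactly because the formula for `h` contains the two sides of the
relation defining `k`, one of them inverted. -/
theorem Stick.pullback_assocCochain :
    pullback (fun x => (AutCat.pi0Equiv G).symm (ψ x)) (AutCat.pi1Equiv G)
      (Reduced.assocCochain σ) = -(σ.factorSet ψ).obstruction := by
  funext x y z
  refine eq_neg_of_add_eq_zero_right (Cen.coe_injective ?_)
  change ((Additive.toMul ((σ.factorSet ψ).obstruction x y z) : Subgroup.center G) : G) *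
    AutCat.unitElt (Reduced.assocCochain σ _ _ _) = 1
  rw [Reduced.unitElt_assocCochain]
  have h := (σ.factorSet ψ).obstruction_spec x y z
  change (σ.X _).aut (σ.mulElt _ _) * σ.mulElt _ ((AutCat.pi0Equiv G).symm (ψ (y * z))) =
    _ * (σ.mulElt _ _ * σ.mulElt ((AutCat.pi0Equiv G).symm (ψ (x * y))) _) at h
  rw [map_mul ψ y z, map_mul ψ x y, map_mul, map_mul] at h
  -- The central `k(x,y,z)` is moved past the two inverses until it meets `f(x,y) f(xy,z)`; the
  -- defining relation then turns the product into `φ_x(f(y,z)) f(x,yz)`, which the inverses cancel.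
  rw [← Cen.left_comm, ← Cen.left_comm, ← h, map_inv, inv_mul_cancel_left, inv_mul_cancel]

theorem Stick.pullback_assocInvCochain :
    pullback (fun x => (AutCat.pi0Equiv G).symm (ψ x)) (AutCat.pi1Equiv G)
      (Reduced.assocInvCochain σ) = (σ.factorSet ψ).obstruction := by
  rw [← neg_neg (σ.factorSet ψ).obstruction, ← σ.pullback_assocCochain ψ]
  funext x y z
  change AutCat.pi1Equiv G (Reduced.assocInvCochain σ _ _ _) = -AutCat.pi1Equiv G _
  rw [Reduced.assocInvCochain_eq_neg, map_neg]

/-- For the kernel `ψ = pi0Equiv`, the pullback of `h` is `h` itself up to the identification of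
coefficients, and it is minus an obstruction cocycle. The cocycle identity returns to `π₁` because
`pi1Equiv` is injective and equivariant. -/
theorem Reduced.assocCochain_mem_Z3 :
    Reduced.assocCochain σ ∈ Z3 (DistribMulAction.toAddMonoidEnd
      (Pi0 (AutCat G)) (Pi1 (AutCat G))) := by
  have h := neg_mem (σ.factorSet (AutCat.pi0Equiv G).toMonoidHom).obstruction_mem_Z3
  rw [← Stick.pullback_assocCochain] at h
  refine AddMonoidHom.mem_ker.2 ?_
  funext w x y z
  apply (AutCat.pi1Equiv G).injective
  have h' := congrFun (congrFun (congrFun (congrFun (AddMonoidHom.mem_ker.1 h) w) x) y) z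
  refine Eq.trans ?_ (h'.trans (map_zero (AutCat.pi1Equiv G)).symm)
  have hs : ∀ s : Pi0 (AutCat G), (AutCat.pi0Equiv G).symm ((AutCat.pi0Equiv G).toMonoidHom s) = s :=
    (AutCat.pi0Equiv G).symm_apply_apply
  simp only [d₃, pullback, AddMonoidHom.coe_mk, ZeroHom.coe_mk, hs, map_add, map_sub]
  have hw : AutCat.pi1Equiv G (DistribMulAction.toAddMonoidEnd (Pi0 (AutCat G)) (Pi1 (AutCat G)) w
      (Reduced.assocCochain σ x y z)) = kernelAction (AutCat.pi0Equiv G).toMonoidHom w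
        (AutCat.pi1Equiv G (Reduced.assocCochain σ x y z)) :=
    AutCat.pi1Equiv_smul w _
  rw [hw]

end StickAut

end GrCat

end

theorem proposition5p1 {P : Type u} [Group P] {G : Type v} [Group G] (ψ : P →* GrCat.OutAut G) :
    ∃ (e₀ : GrCat.Pi0 (GrCat.AutCat G) ≃* GrCat.OutAut G)
      (e₁ : GrCat.Pi1 (GrCat.AutCat G) ≃+ GrCat.Cen G),
      (∀ α : GrCat.AutCat G, e₀ (GrCat.Pi0.mk α) = (α.aut : GrCat.OutAut G)) ∧
      (∀ u : GrCat.Pi1 (GrCat.AutCat G), ((e₁ u).toMul : G) = GrCat.AutCat.unitElt u) ∧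
      (∀ (s : GrCat.Pi0 (GrCat.AutCat G)) (u : GrCat.Pi1 (GrCat.AutCat G)),
        e₁ (s • u) = GrCat.outAction G (e₀ s) (e₁ u)) ∧
      ∀ σ : GrCat.Stick (GrCat.AutCat G),
        GrCat.IsNormalized (GrCat.Reduced.assocCochain σ) ∧
        GrCat.Reduced.assocCochain σ ∈ GrCat.Z3 (DistribMulAction.toAddMonoidEnd
          (GrCat.Pi0 (GrCat.AutCat G)) (GrCat.Pi1 (GrCat.AutCat G))) ∧
        ∃ (h : GrCat.pullback (fun x => e₀.symm (ψ x)) e₁ (GrCat.Reduced.assocCochain σ) ∈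
            GrCat.Z3 (GrCat.kernelAction ψ))
          (h' : GrCat.pullback (fun x => e₀.symm (ψ x)) e₁ (GrCat.Reduced.assocInvCochain σ) ∈
            GrCat.Z3 (GrCat.kernelAction ψ)),
          ∀ F : GrCat.FactorSet ψ, ∃ k : F.obstruction ∈ GrCat.Z3 (GrCat.kernelAction ψ),
            GrCat.H3.mk _ h = -GrCat.H3.mk _ k ∧ GrCat.H3.mk _ h' = GrCat.H3.mk _ k := by
  refine ⟨GrCat.AutCat.pi0Equiv G, GrCat.AutCat.pi1Equiv G, GrCat.AutCat.pi0Equiv_mk,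
    GrCat.AutCat.coe_pi1Equiv, GrCat.AutCat.pi1Equiv_smul, fun σ => ⟨
    GrCat.Reduced.isNormalized_assocCochain σ, GrCat.Reduced.assocCochain_mem_Z3 σ, ?_⟩⟩
  -- Both pullbacks are now `∓k` for the factor set of the stick; comparison with an arbitrary `F`
  -- is independence of the choice of factor set.
  rw [σ.pullback_assocCochain ψ, σ.pullback_assocInvCochain ψ]
  refine ⟨neg_mem (σ.factorSet ψ).obstruction_mem_Z3, (σ.factorSet ψ).obstruction_mem_Z3,
    fun F => ⟨F.obstruction_mem_Z3, ?_⟩⟩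
  have h := GrCat.H3.mk_eq_mk (σ.factorSet ψ).obstruction_mem_Z3 F.obstruction_mem_Z3
    ((σ.factorSet ψ).obstruction_sub_mem_B3 F)
  exact ⟨(GrCat.H3.mk_neg _ _).trans (congrArg Neg.neg h), h⟩
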